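/- Let $S$ be a Polish space with its Borel $\sigma$-algebra, $\mathcal{P}(S)$ the Borel probability measures on $S$, $\mathcal{M}(S)$ the finite signed Borel measures on $S$, and $C_b(S)$ the space of bounded continuous functions $S\to\mathbb{R}$ with the weak topology induced by $\mathcal{M}(S)$, i.e. the coarsest topology making $f\mapsto\int_S f\,d\eta$ continuous for every $\eta\in\mathcal{M}(S)$. A set $\Gamma\subset C_b(S)$ is called admissible if it is convex and closed in this topology, if $g\in\Gamma$ implies $-g\in\Gamma$, if $\Gamma$ contains all constant functions, and if for all $\mu,\nu\in\mathcal{P}(S)$ with $\mu\ne\nu$ there is $g\in\Gamma$ with $\int_S g\,d\mu\neq\int_S g\,d\nu$. For $\Gamma\subset C_b(S)$ and $\mu,\nu\in\mathcal{P}(S)$ let $$G_{\Gamma}(\mu\|\nu)=\sup_{g\in\Gamma}\Big\{\int_S g\,d\mu-\log\int_S e^{g}\,d\nu\Big\},$$ and let $R(\mu\|\nu)=\int_S\log\frac{d\mu}{d\nu}\,d\mu\in[0,\infty]$ if $\mu\ll\nu$ and $R(\mu\|\nu)=\infty$ otherwise. **Proposition.** Let $\Gamma_0\subset C_b(S)$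 be admissible, and write $b\Gamma_0=\{b f: f\in\Gamma_0\}$ for $b>0$. Then for all $\mu,\nu\in\mathcal{P}(S)$, $$\lim_{b\to\infty}G_{b\Gamma_0}(\mu\|\nu)=R(\mu\|\nu),$$ where the limit is taken in the extended real numbers; in particular, the statement holds both when $R(\mu\|\nu)<\infty$ and when $R(\mu\|\nu)=\infty$. -/

import Mathlib

open MeasureTheory Filter Topology BoundedContinuousFunction InformationTheory
open scoped ENNReal Pointwise

/-- The weak topology on `C_b(S)` induced by the space `M(S)` of finite signed Borel measures:
the coarsest topology for which `f ↦ ∫ f dη` is continuous for every finite signed measure `η`. -/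
@[reducible] noncomputable def weakTopologyCb (S : Type*) [TopologicalSpace S] [MeasurableSpace S] :
    TopologicalSpace (S →ᵇ ℝ) :=
  ⨅ η : SignedMeasure S,
    TopologicalSpace.induced (fun f : S →ᵇ ℝ => ∫ᵛ x, f x ∂•η) inferInstance

/-- Admissible sets of test functions. -/
structure IsAdmissible {S : Type*} [TopologicalSpace S] [MeasurableSpace S]
    (Γ : Set (S →ᵇ ℝ)) : Prop where
  convex : Convex ℝ Γ
  closed : IsClosed[weakTopologyCb S] Γ
  symmetric : ∀ g ∈ Γ, -g ∈ Γ
  const_mem : ∀ c : ℝ, BoundedContinuousFunction.const S c ∈ Γ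
  determining : ∀ μ ν : ProbabilityMeasure S, μ ≠ ν →
    ∃ g ∈ Γ, ∫ x, g x ∂(μ : Measure S) ≠ ∫ x, g x ∂(ν : Measure S)

/-- The `Γ`-divergence `G_Γ(μ‖ν) = sup_{g ∈ Γ} {∫ g dμ - log ∫ e^g dν}`,
as an extended real number. -/
noncomputable def gammaDivergence {S : Type*} [TopologicalSpace S] [MeasurableSpace S]
    (Γ : Set (S →ᵇ ℝ)) (μ ν : Measure S) : EReal :=
  ⨆ g ∈ Γ, ((∫ x, g x ∂μ - Real.log (∫ x, Real.exp (g x) ∂ν) : ℝ) : EReal)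

open scoped Classical in
/-- Relative entropy of probability measures: `R(μ‖ν) = ∫ log (dμ/dν) dμ` if `μ ≪ ν`, and
`R(μ‖ν) = ∞` otherwise. If `μ ≪ ν`, the negative part of `log (dμ/dν)` always has a finite
`μ`-integral, so that the integral equals `∞` exactly when `log (dμ/dν)` is not `μ`-integrable. -/
noncomputable def relEntropy {S : Type*} [MeasurableSpace S] (μ ν : Measure S) : EReal :=
  if μ ≪ ν ∧ Integrable (fun x => Real.log (μ.rnDeriv ν x).toReal) μ then
    ((∫ x, Real.log (μ.rnDeriv ν x).toReal ∂μ : ℝ) : EReal)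
  else ⊤

/-- On probability measures, the relative entropy is Mathlib's Kullback-Leibler divergence. -/
theorem relEntropy_eq_klDiv {S : Type*} [MeasurableSpace S] (μ ν : Measure S)
    [IsProbabilityMeasure μ] [IsProbabilityMeasure ν] :
    relEntropy μ ν = (klDiv μ ν : EReal) := by
  by_cases h : μ ≪ ν ∧ Integrable (fun x => Real.log (μ.rnDeriv ν x).toReal) μ
  · have h0 := integral_llr_add_sub_measure_univ_nonneg h.1 h.2
    rw [klDiv_of_ac_of_integrable h.1 h.2, EReal.coe_ennreal_ofReal, max_eq_left h0, relEntropy,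
      if_pos h]
    simp [llr]
  · rw [relEntropy, if_neg h, klDiv_eq_top_iff.2 (fun h1 h2 => h ⟨h1, h2⟩), EReal.coe_ennreal_top]

/-!
The inequality `G_{bΓ₀}(μ‖ν) ≤ R(μ‖ν)` is the easy half of the Donsker–Varadhan formula
(`integral_sub_log_integral_exp_le_relEntropy`): Gibbs' inequality for `μ` and the exponential
tilting of `ν` by `g`.

For the converse, `Γ₀` is convex, symmetric and contains `0`, so the sets `bΓ₀` increase with `b`
and their union is the linear span `V` of `Γ₀`. It remains to see that a bound
`∫ g dμ ≤ c + log ∫ e^g dν` for all `g ∈ V` forces `R(μ‖ν) ≤ c` (`klDiv_le_of_forall_mem_span`).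
The right-hand side is a convex function of `g`, so by a Hahn–Banach theorem with convex majorant
(`exists_extension_of_le_convexOn`) the functional `g ↦ ∫ g dμ` on `V` extends to a linear
functional `L` on all bounded measurable functions with `L h ≤ c + log ∫ e^h dν`. Applied to
multiples of `h`, this bound makes `L` positive, normalized and continuous along bounded pointwise
convergent sequences; hence `L` is integration against a probability measure `γ`
(`exists_probabilityMeasure_of_le_add_log_integral_exp`). Since `γ` and `μ` agree on `Γ₀`, which
determines probability measures, `γ = μ`. So the bound holds for `μ` and *every* bounded measurable
function, and the hard half of the Donsker–Varadhan formula (`klDiv_le_of_forall_integral_le`)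
yields `R(μ‖ν) ≤ c`.

This argument replaces an exchange of supremum and infimum: `V` is dense in `C_b(S)` only for the
weak topology, in which `g ↦ log ∫ e^g dν` need not be continuous.
-/

/-! ### Extension of linear functionals dominated by a convex function -/

/-- **Hahn–Banach theorem** for a convex majorant. The perspective infimum
`N x = inf_{t > 0} t * p (t⁻¹ • x)` is sublinear, lies below `p`, and still dominates every linear
functional that `p` dominates, so the sublinear version applies to it. -/
theorem exists_extension_of_le_convexOn {E : Type*} [AddCommGroup E] [Module ℝ E]
    (f : E →ₗ.[ℝ] ℝ) {p : E → ℝ} (hp : ConvexOn ℝ Set.univ p) (hf : ∀ x : f.domain, f x ≤ p x) :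
    ∃ g : E →ₗ[ℝ] ℝ, (∀ x : f.domain, g x = f x) ∧ ∀ x, g x ≤ p x := by
  have hp0 : 0 ≤ p 0 := by simpa using hf 0
  have bdd : ∀ x, BddBelow (Set.range fun t : Set.Ioi (0 : ℝ) => (t : ℝ) * p ((t : ℝ)⁻¹ • x)) := by
    refine fun x => ⟨-p (-x), ?_⟩
    rintro _ ⟨⟨t, ht⟩, rfl⟩
    have ht : 0 < t := ht
    -- `0` is a convex combination of `t⁻¹ • x` and `-x`
    have h := hp.2 (Set.mem_univ (t⁻¹ • x)) (Set.mem_univ (-x))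
      (by positivity : 0 ≤ t / (t + 1)) (by positivity : 0 ≤ 1 / (t + 1)) (by field_simp)
    have e : (t / (t + 1)) • t⁻¹ • x + (1 / (t + 1)) • (-x) = 0 := by
      rw [smul_smul, smul_neg, ← sub_eq_add_neg, ← sub_smul]
      have : t / (t + 1) * t⁻¹ - 1 / (t + 1) = 0 := by field_simp; ring
      rw [this, zero_smul]
    rw [e] at h
    have h2 : 0 ≤ (t * p (t⁻¹ • x) + p (-x)) / (t + 1) := by
      refine hp0.trans (h.trans_eq ?_)
      simp only [smul_eq_mul]
      ring
    rw [le_div_iff₀ (by positivity), zero_mul] at h2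
    change -p (-x) ≤ t * p (t⁻¹ • x)
    linarith
  set N : E → ℝ := fun x => ⨅ t : Set.Ioi (0 : ℝ), (t : ℝ) * p ((t : ℝ)⁻¹ • x) with hN
  have : Nonempty (Set.Ioi (0 : ℝ)) := ⟨⟨1, Set.mem_Ioi.2 one_pos⟩⟩
  have N_le : ∀ x (t : ℝ), 0 < t → N x ≤ t * p (t⁻¹ • x) := fun x t ht => ciInf_le (bdd x) ⟨t, ht⟩
  have N_hom_le : ∀ c : ℝ, 0 < c → ∀ x, N (c • x) ≤ c * N x := by
    intro c hc x
    rw [hN, Real.mul_iInf_of_nonneg hc.le]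
    refine le_ciInf fun ⟨t, ht⟩ => ?_
    have ht : 0 < t := ht
    have h := N_le (c • x) (c * t) (by positivity)
    rw [smul_smul, show (c * t)⁻¹ * c = t⁻¹ by field_simp] at h
    exact h.trans_eq (by ring)
  have N_hom : ∀ c : ℝ, 0 < c → ∀ x, N (c • x) = c * N x := by
    refine fun c hc x => (N_hom_le c hc x).antisymm ?_
    have h := N_hom_le c⁻¹ (inv_pos.2 hc) (c • x)
    rw [smul_smul, inv_mul_cancel₀ hc.ne', one_smul] at h
    rwa [← le_inv_mul_iff₀ hc]
  have N_add : ∀ x y, N (x + y) ≤ N x + N y := by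
    refine fun x y => le_ciInf_add_ciInf ?_
    rintro ⟨s, hs⟩ ⟨t, ht⟩
    have hs : 0 < s := hs
    have ht : 0 < t := ht
    refine (N_le (x + y) (s + t) (by positivity)).trans ?_
    have h := hp.2 (Set.mem_univ (s⁻¹ • x)) (Set.mem_univ (t⁻¹ • y))
      (by positivity : 0 ≤ s / (s + t)) (by positivity : 0 ≤ t / (s + t)) (by field_simp)
    have e : (s / (s + t)) • s⁻¹ • x + (t / (s + t)) • t⁻¹ • y = (s + t)⁻¹ • (x + y) := by
      rw [smul_smul, smul_smul, smul_add]
      congr 2 <;> field_simp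
    rw [e] at h
    calc (s + t) * p ((s + t)⁻¹ • (x + y))
        ≤ (s + t) * ((s / (s + t)) • p (s⁻¹ • x) + (t / (s + t)) • p (t⁻¹ • y)) := by gcongr
      _ = s * p (s⁻¹ • x) + t * p (t⁻¹ • y) := by
        simp only [smul_eq_mul]
        field_simp
  have hfN : ∀ x : f.domain, f x ≤ N x := by
    refine fun x => le_ciInf fun ⟨t, ht⟩ => ?_
    have ht : 0 < t := ht
    have h := hf (t⁻¹ • x)
    rw [f.map_smul, smul_eq_mul, inv_mul_le_iff₀ ht] at h
    exact h
  obtain ⟨g, hg, hgN⟩ := exists_extension_of_le_sublinear f N N_hom N_add hfN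
  exact ⟨g, hg, fun x => (hgN x).trans (by simpa using N_le x 1 one_pos)⟩

/-! ### Bounded measurable functions and the log-moment functional -/

/-- The space of bounded measurable real functions, as a subspace of all functions. -/
def boundedMeasurable (S : Type*) [MeasurableSpace S] : Submodule ℝ (S → ℝ) where
  carrier := {h | Measurable h ∧ ∃ C, ∀ x, |h x| ≤ C}
  zero_mem' := ⟨measurable_zero, 0, by simp⟩
  add_mem' := by
    rintro f g ⟨hf, C, hC⟩ ⟨hg, D, hD⟩
    exact ⟨hf.add hg, C + D, fun x => (abs_add_le _ _).trans (add_le_add (hC x) (hD x))⟩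
  smul_mem' := by
    rintro a f ⟨hf, C, hC⟩
    refine ⟨hf.const_smul a, |a| * C, fun x => ?_⟩
    rw [Pi.smul_apply, smul_eq_mul, abs_mul]
    exact mul_le_mul_of_nonneg_left (hC x) (abs_nonneg a)

section LogMoment

variable {S : Type*} [MeasurableSpace S]

theorem integrable_of_bound (μ : Measure S) [IsFiniteMeasure μ] {h : S → ℝ} (hm : Measurable h)
    {C : ℝ} (hC : ∀ x, |h x| ≤ C) : Integrable h μ :=
  .of_bound hm.aestronglyMeasurable C (ae_of_all _ hC)

theorem integrable_boundedMeasurable (μ : Measure S) [IsFiniteMeasure μ]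
    (h : boundedMeasurable S) : Integrable h.1 μ :=
  have ⟨_, hC⟩ := h.2.2
  integrable_of_bound μ h.2.1 hC

theorem integrable_exp_boundedMeasurable (μ : Measure S) [IsFiniteMeasure μ]
    (h : boundedMeasurable S) : Integrable (fun x => Real.exp (h.1 x)) μ := by
  obtain ⟨C, hC⟩ := h.2.2
  refine integrable_of_bound μ (Real.measurable_exp.comp h.2.1) (C := Real.exp C) fun x => ?_
  rw [abs_of_pos (Real.exp_pos _)]
  exact Real.exp_le_exp.2 ((le_abs_self _).trans (hC x))

/-- Integration as a linear functional on bounded measurable functions. -/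
noncomputable def boundedIntegral (μ : Measure S) [IsFiniteMeasure μ] :
    boundedMeasurable S →ₗ[ℝ] ℝ where
  toFun h := ∫ x, h.1 x ∂μ
  map_add' f g := integral_add (integrable_boundedMeasurable μ f) (integrable_boundedMeasurable μ g)
  map_smul' a f := integral_smul a f.1

/-- The functional `h ↦ log ∫ e^h dν` is convex: after subtracting from each of two functions its
log-moment, this is the convexity of `exp`. -/
theorem convexOn_log_integral_exp (ν : Measure S) [IsProbabilityMeasure ν] :
    ConvexOn ℝ Set.univ
      (fun h : boundedMeasurable S => Real.log (∫ x, Real.exp (h.1 x) ∂ν)) := by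
  refine ⟨convex_univ, fun f _ g _ a b ha hb hab => ?_⟩
  have hf := integral_exp_pos (integrable_exp_boundedMeasurable ν f)
  have hg := integral_exp_pos (integrable_exp_boundedMeasurable ν g)
  have hfg := integral_exp_pos (integrable_exp_boundedMeasurable ν (a • f + b • g))
  set A := Real.log (∫ x, Real.exp (f.1 x) ∂ν) with hA
  set B := Real.log (∫ x, Real.exp (g.1 x) ∂ν) with hB
  simp only [smul_eq_mul]
  rw [Real.log_le_iff_le_exp hfg]
  have key : ∀ x, Real.exp ((a • f + b • g).1 x) ≤
      Real.exp (a * A + b * B) *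
        (a * (Real.exp (-A) * Real.exp (f.1 x)) + b * (Real.exp (-B) * Real.exp (g.1 x))) := by
    intro x
    have h := convexOn_exp.2 (Set.mem_univ (-A + f.1 x)) (Set.mem_univ (-B + g.1 x)) ha hb hab
    simp only [smul_eq_mul] at h
    rw [← Real.exp_add, ← Real.exp_add]
    have e : (a • f + b • g).1 x = (a * A + b * B) + (a * (-A + f.1 x) + b * (-B + g.1 x)) := by
      change a * f.1 x + b * g.1 x = _
      ring
    rw [e, Real.exp_add]
    gcongr
  have i1 := ((integrable_exp_boundedMeasurable ν f).const_mul (Real.exp (-A))).const_mul a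
  have i2 := ((integrable_exp_boundedMeasurable ν g).const_mul (Real.exp (-B))).const_mul b
  refine (integral_mono (integrable_exp_boundedMeasurable ν (a • f + b • g))
    ((i1.add i2).const_mul (Real.exp (a * A + b * B))) key).trans_eq ?_
  simp only [Pi.add_apply]
  rw [integral_const_mul, integral_add i1 i2, integral_const_mul, integral_const_mul,
    integral_const_mul, integral_const_mul, Real.exp_neg, Real.exp_neg, hA, hB, Real.exp_log hf,
    Real.exp_log hg, inv_mul_cancel₀ hf.ne', inv_mul_cancel₀ hg.ne', mul_one, mul_one, hab, mul_one]

end LogMoment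

/-! ### Functionals dominated by the log-moment functional are measures -/

section Representation

variable {S : Type*} [MeasurableSpace S]

/-- The indicator function of a measurable set, as a bounded measurable function. -/
noncomputable def indicatorBM (A : Set S) (hA : MeasurableSet A) : boundedMeasurable S :=
  ⟨A.indicator fun _ => 1, measurable_const.indicator hA, 1, fun x => by
    by_cases hx : x ∈ A <;> simp [hx]⟩

variable {ν : Measure S} [IsProbabilityMeasure ν] {c : ℝ} {L : boundedMeasurable S →ₗ[ℝ] ℝ}

theorem nonneg_of_le_add_log_integral_exp
    (hL : ∀ h, L h ≤ c + Real.log (∫ x, Real.exp (h.1 x) ∂ν)) : 0 ≤ c := by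
  simpa using hL 0

/-- Scaling turns domination by the log-moment functional into continuity along bounded pointwise
convergent sequences: `t * L h ≤ c + log ∫ e^{t h} dν`, and the logarithm tends to `0` for every
fixed `t`. -/
theorem tendsto_zero_of_le_add_log_integral_exp
    (hL : ∀ h, L h ≤ c + Real.log (∫ x, Real.exp (h.1 x) ∂ν))
    (h : ℕ → boundedMeasurable S) {C : ℝ} (hC : ∀ n x, |(h n).1 x| ≤ C)
    (h0 : ∀ x, Tendsto (fun n => (h n).1 x) atTop (𝓝 0)) :
    Tendsto (fun n => L (h n)) atTop (𝓝 0) := by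
  have hc := nonneg_of_le_add_log_integral_exp hL
  have upper : ∀ g : ℕ → boundedMeasurable S, (∀ n x, |(g n).1 x| ≤ C) →
      (∀ x, Tendsto (fun n => (g n).1 x) atTop (𝓝 0)) → ∀ ε > 0, ∀ᶠ n in atTop, L (g n) < ε := by
    intro g gC g0 ε hε
    set t := (c + 1) / ε with ht
    have htpos : 0 < t := by positivity
    have hint : Tendsto (fun n => ∫ x, Real.exp ((t • g n).1 x) ∂ν) atTop
        (𝓝 (∫ _, Real.exp 0 ∂ν)) := by
      refine tendsto_integral_of_dominated_convergence (fun _ => Real.exp (t * C))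
        (fun n => (integrable_exp_boundedMeasurable ν (t • g n)).aestronglyMeasurable)
        (integrable_const _) (fun n => ae_of_all _ fun x => ?_) (ae_of_all _ fun x => ?_)
      · rw [Real.norm_of_nonneg (Real.exp_pos _).le]
        exact Real.exp_le_exp.2
          (mul_le_mul_of_nonneg_left ((le_abs_self _).trans (gC n x)) htpos.le)
      · have := (g0 x).const_mul t
        rw [mul_zero] at this
        exact (Real.continuous_exp.tendsto 0).comp this
    have hlog := hint.log (by simp)
    rw [show Real.log (∫ _, Real.exp 0 ∂ν) = 0 by simp] at hlog
    filter_upwards [hlog.eventually_lt_const one_pos] with n hn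
    have h1 := hL (t • g n)
    rw [map_smul, smul_eq_mul] at h1
    have h2 : t * L (g n) < t * ε := by
      rw [ht, div_mul_cancel₀ _ hε.ne', ← ht]
      linarith
    exact lt_of_mul_lt_mul_left h2 htpos.le
  rw [Metric.tendsto_atTop']
  intro ε hε
  have h1 := upper h hC h0 ε hε
  have h2 := upper (fun n => -h n) (fun n x => (abs_neg _).trans_le (hC n x))
    (fun x => by simpa using (h0 x).neg) ε hε
  obtain ⟨N, hN⟩ := eventually_atTop.1 (h1.and h2)
  refine ⟨N, fun n hn => ?_⟩
  obtain ⟨h3, h4⟩ := hN n hn.le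
  rw [map_neg] at h4
  rw [Real.dist_eq, sub_zero, abs_lt]
  exact ⟨by linarith, h3⟩

theorem nonneg_apply_of_le_add_log_integral_exp
    (hL : ∀ h, L h ≤ c + Real.log (∫ x, Real.exp (h.1 x) ∂ν))
    (h : boundedMeasurable S) (hh : ∀ x, 0 ≤ h.1 x) : 0 ≤ L h := by
  have key : ∀ t : ℝ, 0 < t → -(t * L h) ≤ c := by
    intro t ht
    have h1 := hL (-(t • h))
    rw [map_neg, map_smul, smul_eq_mul] at h1
    have h2 : ∫ x, Real.exp ((-(t • h)).1 x) ∂ν ≤ 1 := by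
      refine (integral_mono (integrable_exp_boundedMeasurable ν (-(t • h))) (integrable_const 1)
        fun x => ?_).trans_eq (by simp)
      exact Real.exp_le_one_iff.2 (neg_nonpos.2 (mul_nonneg ht.le (hh x)))
    have h3 := Real.log_nonpos (integral_exp_pos
      (integrable_exp_boundedMeasurable ν (-(t • h)))).le h2
    linarith
  by_contra! hneg
  have hc := nonneg_of_le_add_log_integral_exp hL
  have := key ((c + 1) / -L h) (div_pos (by linarith) (by linarith))
  rw [div_mul_eq_mul_div, div_neg, neg_neg, mul_div_cancel_right₀ _ hneg.ne] at this
  linarith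

theorem apply_one_of_le_add_log_integral_exp
    (hL : ∀ h, L h ≤ c + Real.log (∫ x, Real.exp (h.1 x) ∂ν)) :
    L (indicatorBM Set.univ .univ) = 1 := by
  set u := L (indicatorBM Set.univ .univ) with hu
  have key : ∀ t : ℝ, t * (u - 1) ≤ c := by
    intro t
    have h1 := hL (t • indicatorBM Set.univ .univ)
    have e : ∫ x, Real.exp ((t • indicatorBM (S := S) Set.univ .univ).1 x) ∂ν = Real.exp t := by
      simp [indicatorBM]
    rw [e, Real.log_exp, map_smul, smul_eq_mul] at h1
    linarith
  by_contra hne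
  have hne : u - 1 ≠ 0 := sub_ne_zero.2 hne
  have := key ((c + 1) / (u - 1))
  rw [div_mul_cancel₀ _ hne] at this
  linarith

theorem hasSum_indicatorBM_of_le_add_log_integral_exp
    (hL : ∀ h, L h ≤ c + Real.log (∫ x, Real.exp (h.1 x) ∂ν))
    {A : ℕ → Set S} (hA : ∀ i, MeasurableSet (A i)) (hd : Pairwise (Function.onFun Disjoint A)) :
    HasSum (fun i => L (indicatorBM (A i) (hA i)))
      (L (indicatorBM (⋃ i, A i) (MeasurableSet.iUnion hA))) := by
  rw [hasSum_iff_tendsto_nat_of_nonneg fun i =>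
    nonneg_apply_of_le_add_log_integral_exp hL _
      fun x => Set.indicator_nonneg (fun _ _ => zero_le_one) x]
  set T : ℕ → boundedMeasurable S := fun n =>
    ∑ i ∈ Finset.range n, indicatorBM (A i) (hA i) -
      indicatorBM (⋃ i, A i) (MeasurableSet.iUnion hA) with hT
  have hTx : ∀ n x, (T n).1 x = (⋃ i ∈ Finset.range n, A i).indicator (fun _ => (1 : ℝ)) x -
      (⋃ i, A i).indicator (fun _ => (1 : ℝ)) x := by
    intro n x
    rw [Finset.indicator_biUnion_apply _ _ (fun i _ j _ hij => hd hij)]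
    simp [hT, indicatorBM]
  have h := tendsto_zero_of_le_add_log_integral_exp hL T (C := 1) (fun n x => ?_) fun x => ?_
  · rw [← tendsto_sub_nhds_zero_iff]
    simpa [hT] using h
  · rw [hTx]
    by_cases h1 : x ∈ ⋃ i ∈ Finset.range n, A i <;> by_cases h2 : x ∈ ⋃ i, A i <;>
      simp only [Set.indicator_of_mem, Set.indicator_of_notMem, h1, h2, not_false_eq_true] <;>
      norm_num
  · refine tendsto_const_nhds.congr' ?_
    by_cases hx : x ∈ ⋃ i, A i
    · obtain ⟨k, hk⟩ := Set.mem_iUnion.1 hx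
      filter_upwards [eventually_gt_atTop k] with n hn
      have h1 : x ∈ ⋃ i ∈ Finset.range n, A i :=
        Set.mem_biUnion (Finset.mem_coe.2 (Finset.mem_range.2 hn)) hk
      rw [hTx, Set.indicator_of_mem hx, Set.indicator_of_mem h1, sub_self]
    · refine Eventually.of_forall fun n => ?_
      have h1 : x ∉ ⋃ i ∈ Finset.range n, A i := fun h =>
        hx (Set.iUnion₂_subset_iUnion _ _ h)
      simp only [hTx]
      rw [Set.indicator_of_notMem hx, Set.indicator_of_notMem h1, sub_self]

/-- A linear functional on bounded measurable functions dominated by `c + log ∫ e^h dν` is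
integration against a probability measure. -/
theorem exists_probabilityMeasure_of_le_add_log_integral_exp
    (hL : ∀ h, L h ≤ c + Real.log (∫ x, Real.exp (h.1 x) ∂ν)) :
    ∃ γ : ProbabilityMeasure S, ∀ h, L h = ∫ x, h.1 x ∂(γ : Measure S) := by
  have hnn : ∀ A hA, 0 ≤ L (indicatorBM A hA) := fun A hA =>
    nonneg_apply_of_le_add_log_integral_exp hL _
      fun x => Set.indicator_nonneg (fun _ _ => zero_le_one) x
  let γ : Measure S := Measure.ofMeasurable (fun A hA => ENNReal.ofReal (L (indicatorBM A hA)))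
    (by
      have : indicatorBM (∅ : Set S) .empty = 0 := Subtype.ext (Set.indicator_empty _)
      rw [this, map_zero, ENNReal.ofReal_zero])
    (fun A hA hd => by
      have h := hasSum_indicatorBM_of_le_add_log_integral_exp hL hA hd
      rw [← h.tsum_eq, ENNReal.ofReal_tsum_of_nonneg (fun i => hnn _ _) h.summable])
  have hγ : ∀ A (hA : MeasurableSet A), γ A = ENNReal.ofReal (L (indicatorBM A hA)) :=
    fun A hA => Measure.ofMeasurable_apply A hA
  have hprob : IsProbabilityMeasure γ :=
    ⟨by rw [hγ _ .univ, apply_one_of_le_add_log_integral_exp hL, ENNReal.ofReal_one]⟩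
  have hind : ∀ A hA, L (indicatorBM A hA) = ∫ x, (indicatorBM A hA).1 x ∂γ := by
    intro A hA
    have : ∫ x, (indicatorBM A hA).1 x ∂γ = γ.real A := integral_indicator_one hA
    rw [this, measureReal_def, hγ A hA, ENNReal.toReal_ofReal (hnn A hA)]
  have hsimple : ∀ f : SimpleFunc S ℝ, ∀ hf : (f : S → ℝ) ∈ boundedMeasurable S,
      L ⟨f, hf⟩ = boundedIntegral γ ⟨f, hf⟩ := by
    intro f
    induction f using SimpleFunc.induction with
    | const a hs =>
      rename_i s
      intro hf
      have e : (⟨_, hf⟩ : boundedMeasurable S) = a • indicatorBM s hs := by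
        refine Subtype.ext (funext fun x => ?_)
        by_cases hx : x ∈ s <;> simp [indicatorBM, hx]
      rw [e, map_smul, map_smul, hind]
      rfl
    | add hd ihf ihg =>
      rename_i f g
      intro hf
      have bd : ∀ f : SimpleFunc S ℝ, (f : S → ℝ) ∈ boundedMeasurable S := fun f =>
        ⟨f.measurable, f.exists_forall_norm_le⟩
      have e : (⟨_, hf⟩ : boundedMeasurable S) = ⟨f, bd f⟩ + ⟨g, bd g⟩ := rfl
      rw [e, map_add, map_add, ihf, ihg]
  refine ⟨⟨γ, hprob⟩, fun h => ?_⟩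
  obtain ⟨C, hC⟩ := h.2.2
  have hsm := h.2.1.stronglyMeasurable
  have hC' : ∀ n x, ‖hsm.approxBounded |C| n x‖ ≤ |C| := hsm.norm_approxBounded_le (abs_nonneg C)
  have hlim : ∀ x, Tendsto (fun n => hsm.approxBounded |C| n x) atTop (𝓝 (h.1 x)) := fun x =>
    StronglyMeasurable.tendsto_approxBounded_of_norm_le hsm ((hC x).trans (le_abs_self C))
  let a : ℕ → boundedMeasurable S := fun n =>
    ⟨hsm.approxBounded |C| n, (hsm.approxBounded |C| n).measurable, |C|, hC' n⟩
  have h1 : Tendsto (fun n => L (a n)) atTop (𝓝 (L h)) := by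
    rw [← tendsto_sub_nhds_zero_iff]
    refine (tendsto_zero_of_le_add_log_integral_exp hL (fun n => a n - h) (C := |C| + |C|)
      (fun n x => ?_) fun x => ?_).congr fun n => map_sub _ _ _
    · exact (abs_sub _ _).trans (add_le_add (hC' n x) ((hC x).trans (le_abs_self C)))
    · exact tendsto_sub_nhds_zero_iff.2 (hlim x)
  have h2 : Tendsto (fun n => ∫ x, (a n).1 x ∂γ) atTop (𝓝 (∫ x, h.1 x ∂γ)) :=
    tendsto_integral_of_dominated_convergence (fun _ => |C|)
      (fun n => (integrable_boundedMeasurable γ (a n)).aestronglyMeasurable)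
      (integrable_const _) (fun n => ae_of_all _ (hC' n)) (ae_of_all _ hlim)
  exact tendsto_nhds_unique h1 (h2.congr fun n => (hsimple _ (a n).2).symm)

end Representation

/-! ### The Donsker–Varadhan variational formula -/

section DonskerVaradhan

variable {S : Type*} [MeasurableSpace S]

theorem integral_sub_log_integral_exp_le_relEntropy (μ ν : Measure S) [IsProbabilityMeasure μ]
    [IsProbabilityMeasure ν] {g : S → ℝ} (hg : Measurable g) {C : ℝ} (hC : ∀ x, |g x| ≤ C) :
    ((∫ x, g x ∂μ - Real.log (∫ x, Real.exp (g x) ∂ν) : ℝ) : EReal) ≤ relEntropy μ ν := by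
  rw [relEntropy]
  split_ifs with h
  · have hexp : Integrable (fun x => Real.exp (g x)) ν :=
      integrable_exp_boundedMeasurable ν ⟨g, hg, C, hC⟩
    have hgμ := integrable_of_bound μ hg hC
    have := isProbabilityMeasure_tilted hexp
    have hac : μ ≪ ν.tilted g := h.1.trans (absolutelyContinuous_tilted hexp)
    have h1 := integral_llr_add_sub_measure_univ_nonneg hac
      (integrable_llr_tilted_right h.1 hgμ h.2 hexp)
    rw [integral_llr_tilted_right h.1 hgμ hexp h.2] at h1
    simp only [llr, probReal_univ] at h1
    exact EReal.coe_le_coe_iff.2 (by linarith)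
  · exact le_top

/-- The integrand of the Donsker–Varadhan functional is nonnegative at truncations: if `k > 0` lies
between `1` and `r`, then `r * log k + 1 - k ≥ 0`. -/
theorem mul_log_add_one_sub_nonneg {r k : ℝ} (hk : 0 < k)
    (h : (1 ≤ k ∧ k ≤ r) ∨ (k ≤ 1 ∧ r ≤ k)) : 0 ≤ r * Real.log k + 1 - k := by
  have h0 := klFun_nonneg hk.le
  rw [klFun_apply] at h0
  rcases h with ⟨h1, h2⟩ | ⟨h1, h2⟩
  · have := mul_le_mul_of_nonneg_right h2 (Real.log_nonneg h1)
    linarith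
  · have := mul_le_mul_of_nonpos_right h2 (Real.log_nonpos hk.le h1)
    linarith

/-- The truncation of `r` to the interval `[1 / (n + 1), n + 1]`. -/
noncomputable def clampAt (n : ℕ) (r : ℝ) : ℝ := max (1 / ((n : ℝ) + 1)) (min r (n + 1))

theorem clampAt_pos (n : ℕ) (r : ℝ) : 0 < clampAt n r :=
  lt_max_of_lt_left (by positivity)

theorem clampAt_mul_log_nonneg (n : ℕ) (r : ℝ) :
    0 ≤ r * Real.log (clampAt n r) + 1 - clampAt n r := by
  refine mul_log_add_one_sub_nonneg (clampAt_pos n r) ?_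
  have h1 : 1 / ((n : ℝ) + 1) ≤ 1 := by
    rw [div_le_one (by positivity)]
    linarith [n.cast_nonneg (α := ℝ)]
  have h2 : (1 : ℝ) ≤ n + 1 := by linarith [n.cast_nonneg (α := ℝ)]
  unfold clampAt
  grind

/-- At `r = 0` the truncation does not become constant; there the limit is `1 = klFun 0`. -/
theorem tendsto_clampAt_klFun {r : ℝ} (hr : 0 ≤ r) :
    Tendsto (fun n : ℕ => r * Real.log (clampAt n r) + 1 - clampAt n r) atTop (𝓝 (klFun r)) := by
  have hn : Tendsto (fun n : ℕ => 1 / ((n : ℝ) + 1)) atTop (𝓝 0) :=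
    tendsto_one_div_add_atTop_nhds_zero_nat
  rcases hr.eq_or_lt with rfl | hr
  · rw [klFun_zero]
    have e : ∀ n : ℕ, (0 : ℝ) * Real.log (clampAt n 0) + 1 - clampAt n 0
        = 1 - 1 / ((n : ℝ) + 1) := by
      intro n
      have h1 : (0 : ℝ) ≤ n + 1 := by positivity
      have h2 : (0 : ℝ) ≤ 1 / ((n : ℝ) + 1) := by positivity
      rw [clampAt, min_eq_left h1, max_eq_left h2]
      ring
    simp_rw [e]
    simpa using hn.const_sub 1
  · refine tendsto_const_nhds.congr' ?_
    filter_upwards [hn.eventually_le_const hr, eventually_ge_atTop ⌈r⌉₊] with n h1 h2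
    have h3 : r ≤ n + 1 := by linarith [Nat.ceil_le.1 h2]
    rw [clampAt, min_eq_left h3, max_eq_right h1, klFun_apply]

/-- The hard half of the Donsker–Varadhan formula: the test functions are the logarithms of the
truncated density, and Fatou's lemma removes the truncation. -/
theorem klDiv_le_of_forall_integral_le (μ ν : Measure S) [IsProbabilityMeasure μ]
    [IsProbabilityMeasure ν] {c : ℝ} (H : ∀ h : boundedMeasurable S,
      ∫ x, h.1 x ∂μ ≤ c + Real.log (∫ x, Real.exp (h.1 x) ∂ν)) :
    klDiv μ ν ≤ ENNReal.ofReal c := by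
  have hac : μ ≪ ν := by
    refine Measure.AbsolutelyContinuous.mk fun A hA hA0 => ?_
    -- `t • 1_A` has trivial log-moment for every `t`, so `t * μ A ≤ c` for every `t`
    have hμ : ∀ t : ℝ, t * μ.real A ≤ c := by
      intro t
      have h := H ⟨A.indicator fun _ => t, measurable_const.indicator hA, |t|, fun x => by
        by_cases hx : x ∈ A <;> simp [hx]⟩
      have e : (fun x => Real.exp (A.indicator (fun _ => t) x)) =ᵐ[ν] fun _ => 1 := by
        filter_upwards [measure_eq_zero_iff_ae_notMem.1 hA0] with x hx
        simp [hx]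
      simp only [integral_congr_ae e, integral_indicator_const _ hA] at h
      simpa [mul_comm] using h
    by_contra hne
    have hpos : 0 < μ.real A := ENNReal.toReal_pos hne (measure_ne_top _ _)
    have := hμ ((c + 1) / μ.real A)
    rw [div_mul_cancel₀ _ hpos.ne'] at this
    linarith
  set r : S → ℝ := fun x => (μ.rnDeriv ν x).toReal with hr
  have hrm : Measurable r := (Measure.measurable_rnDeriv μ ν).ennreal_toReal
  have hcm : ∀ n, Measurable fun x => clampAt n (r x) := fun n =>
    measurable_const.max (hrm.min measurable_const)
  set F : ℕ → S → ℝ := fun n x => r x * Real.log (clampAt n (r x)) + 1 - clampAt n (r x) with hF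
  have hbound : ∀ n : ℕ, ∫⁻ x, ENNReal.ofReal (F n x) ∂ν ≤ ENNReal.ofReal c := by
    intro n
    have hlogb : ∀ x, |Real.log (clampAt n (r x))| ≤ Real.log (n + 1) := by
      intro x
      have h1 : (1 : ℝ) ≤ n + 1 := by linarith [n.cast_nonneg (α := ℝ)]
      have h0 : 1 / ((n : ℝ) + 1) ≤ n + 1 := by
        rw [div_le_iff₀ (by positivity)]; nlinarith
      rw [abs_le, ← Real.log_inv, ← one_div]
      exact ⟨Real.log_le_log (by positivity) (le_max_left _ _),
        Real.log_le_log (clampAt_pos _ _) (max_le h0 (min_le_right _ _))⟩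
    let h : boundedMeasurable S := ⟨fun x => Real.log (clampAt n (r x)),
      Real.measurable_log.comp (hcm n), _, hlogb⟩
    have iexp := integrable_exp_boundedMeasurable ν h
    have hH := H h
    have eexp : (fun x => Real.exp (h.1 x)) = fun x => clampAt n (r x) :=
      funext fun x => Real.exp_log (clampAt_pos n (r x))
    have icl : Integrable (fun x => clampAt n (r x)) ν := eexp ▸ iexp
    rw [eexp] at hH
    have irl : Integrable (fun x => r x * Real.log (clampAt n (r x))) ν :=
      (integrable_rnDeriv_smul_iff hac).2 (integrable_boundedMeasurable μ h)
    have erl : ∫ x, r x * Real.log (clampAt n (r x)) ∂ν = ∫ x, h.1 x ∂μ :=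
      integral_rnDeriv_smul hac
    have iF : Integrable (F n) ν := (irl.add (integrable_const 1)).sub icl
    rw [← ofReal_integral_eq_lintegral_ofReal iF
      (ae_of_all _ fun x => clampAt_mul_log_nonneg n (r x))]
    refine ENNReal.ofReal_le_ofReal ?_
    have e1 : ∫ x, F n x ∂ν = ∫ x, h.1 x ∂μ + 1 - ∫ x, clampAt n (r x) ∂ν := by
      refine (integral_sub (irl.add (integrable_const 1)) icl).trans ?_
      congr 1
      refine (integral_add irl (integrable_const 1)).trans ?_
      rw [erl, integral_const, probReal_univ, one_smul]
    have hpos : 0 < ∫ x, clampAt n (r x) ∂ν := eexp ▸ integral_exp_pos iexp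
    have := Real.log_le_sub_one_of_pos hpos
    rw [e1]
    linarith
  rw [klDiv_eq_lintegral_klFun_of_ac hac]
  calc ∫⁻ x, ENNReal.ofReal (klFun (r x)) ∂ν
      = ∫⁻ x, liminf (fun n => ENNReal.ofReal (F n x)) atTop ∂ν := by
        refine lintegral_congr fun x => ?_
        exact (ENNReal.tendsto_ofReal
          (tendsto_clampAt_klFun ENNReal.toReal_nonneg)).liminf_eq.symm
    _ ≤ liminf (fun n => ∫⁻ x, ENNReal.ofReal (F n x) ∂ν) atTop := by
        refine lintegral_liminf_le fun n => ENNReal.measurable_ofReal.comp ?_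
        exact ((hrm.mul (Real.measurable_log.comp (hcm n))).add_const 1).sub (hcm n)
    _ ≤ ENNReal.ofReal c := by
        refine (liminf_le_liminf (Eventually.of_forall hbound)).trans_eq ?_
        simp

end DonskerVaradhan

/-! ### Dilations of an admissible set -/

section Dilations

/-- The dilations of a symmetric convex set containing `0` exhaust its linear span. -/
theorem exists_mem_smul_of_mem_span {E : Type*} [AddCommGroup E] [Module ℝ E] {Γ : Set E}
    (hconv : Convex ℝ Γ) (hsymm : ∀ g ∈ Γ, -g ∈ Γ) (h0 : (0 : E) ∈ Γ) {g : E}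
    (hg : g ∈ Submodule.span ℝ Γ) : ∃ b : ℝ, 0 ≤ b ∧ g ∈ b • Γ := by
  induction hg using Submodule.span_induction with
  | mem x hx => exact ⟨1, zero_le_one, by rwa [one_smul]⟩
  | zero => exact ⟨0, le_rfl, 0, h0, smul_zero 0⟩
  | add x y _ _ hx hy =>
    obtain ⟨b, hb, hx⟩ := hx
    obtain ⟨d, hd, hy⟩ := hy
    exact ⟨b + d, add_nonneg hb hd, by rw [hconv.add_smul hb hd]; exact Set.add_mem_add hx hy⟩
  | smul a x _ hx =>
    obtain ⟨b, hb, u, hu, rfl⟩ := hx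
    rcases le_total 0 a with ha | ha
    · exact ⟨a * b, mul_nonneg ha hb, u, hu, mul_smul a b u⟩
    · refine ⟨-a * b, mul_nonneg (neg_nonneg.2 ha) hb, -u, hsymm u hu, ?_⟩
      change (-a * b) • -u = a • b • u
      rw [smul_neg, neg_mul, neg_smul, neg_neg, mul_smul]

theorem smul_set_subset_smul_set {E : Type*} [AddCommGroup E] [Module ℝ E] {Γ : Set E}
    (hconv : Convex ℝ Γ) (h0 : (0 : E) ∈ Γ) {b d : ℝ} (hb : 0 ≤ b) (hbd : b ≤ d) :
    b • Γ ⊆ d • Γ := by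
  intro x hx
  have h := hconv.add_smul hb (sub_nonneg.2 hbd)
  rw [add_sub_cancel] at h
  rw [h, ← add_zero x]
  exact Set.add_mem_add hx ⟨0, h0, smul_zero _⟩

variable {S : Type*} [TopologicalSpace S] [MeasurableSpace S]

/-- The inclusion of bounded continuous functions into bounded measurable functions. -/
def toBoundedMeasurable [OpensMeasurableSpace S] : (S →ᵇ ℝ) →ₗ[ℝ] boundedMeasurable S where
  toFun g := ⟨g, g.continuous.measurable, ‖g‖, g.norm_coe_le_norm⟩
  map_add' _ _ := rfl
  map_smul' _ _ := rfl

theorem le_gammaDivergence {Γ : Set (S →ᵇ ℝ)} {g : S →ᵇ ℝ} (hg : g ∈ Γ) (μ ν : Measure S) :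
    ((∫ x, g x ∂μ - Real.log (∫ x, Real.exp (g x) ∂ν) : ℝ) : EReal) ≤ gammaDivergence Γ μ ν :=
  le_iSup₂ (f := fun (g : S →ᵇ ℝ) (_ : g ∈ Γ) =>
    ((∫ x, g x ∂μ - Real.log (∫ x, Real.exp (g x) ∂ν) : ℝ) : EReal)) g hg

theorem gammaDivergence_le_relEntropy [OpensMeasurableSpace S] (Γ : Set (S →ᵇ ℝ))
    (μ ν : Measure S) [IsProbabilityMeasure μ] [IsProbabilityMeasure ν] :
    gammaDivergence Γ μ ν ≤ relEntropy μ ν :=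
  iSup₂_le fun g _ => integral_sub_log_integral_exp_le_relEntropy μ ν g.continuous.measurable
    g.norm_coe_le_norm

/-- A bound for the variational functional on the span of an admissible set bounds the relative
entropy. The functional `∫ · dμ` on the span extends to a functional on all bounded measurable
functions with the same bound; it is integration against some `γ`, and `γ = μ` because the
admissible set determines probability measures. -/
theorem klDiv_le_of_forall_mem_span [OpensMeasurableSpace S] {Γ : Set (S →ᵇ ℝ)}
    (hΓ : IsAdmissible Γ) (μ ν : Measure S) [IsProbabilityMeasure μ] [IsProbabilityMeasure ν]
    {c : ℝ} (H : ∀ g ∈ Submodule.span ℝ Γ,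
      ∫ x, g x ∂μ - Real.log (∫ x, Real.exp (g x) ∂ν) ≤ c) :
    klDiv μ ν ≤ ENNReal.ofReal c := by
  let f : boundedMeasurable S →ₗ.[ℝ] ℝ :=
    (boundedIntegral μ).toPMap ((Submodule.span ℝ Γ).map toBoundedMeasurable)
  obtain ⟨L, hLf, hL⟩ := exists_extension_of_le_convexOn f
    ((convexOn_const c convex_univ).add (convexOn_log_integral_exp ν)) (by
      rintro ⟨_, g, hg, rfl⟩
      have := H g hg
      change ∫ x, g x ∂μ ≤ c + Real.log (∫ x, Real.exp (g x) ∂ν)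
      linarith)
  obtain ⟨γ, hγ⟩ := exists_probabilityMeasure_of_le_add_log_integral_exp hL
  have hγμ : γ = ⟨μ, inferInstance⟩ := by
    by_contra hne
    obtain ⟨g, hg, hgne⟩ := hΓ.determining _ _ hne
    have h1 := hLf ⟨toBoundedMeasurable g, g, Submodule.subset_span hg, rfl⟩
    exact hgne ((hγ (toBoundedMeasurable g)).symm.trans h1)
  refine klDiv_le_of_forall_integral_le μ ν fun h => ?_
  have h1 := hγ h
  rw [hγμ] at h1
  exact h1.symm.trans_le (hL h)

end Dilations

theorem mainTheorem6 {S : Type*} [TopologicalSpace S] [PolishSpace S] [MeasurableSpace S]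
    [BorelSpace S] (Γ₀ : Set (S →ᵇ ℝ)) (hΓ₀ : IsAdmissible Γ₀)
    (μ ν : Measure S) [IsProbabilityMeasure μ] [IsProbabilityMeasure ν] :
    Tendsto (fun b : ℝ => gammaDivergence (b • Γ₀) μ ν) atTop (𝓝 (relEntropy μ ν)) := by
  have h0 : (0 : S →ᵇ ℝ) ∈ Γ₀ := hΓ₀.const_mem 0
  refine tendsto_order.2 ⟨fun a ha => ?_, fun a ha => Eventually.of_forall fun b =>
    (gammaDivergence_le_relEntropy _ μ ν).trans_lt ha⟩
  by_contra hev
  simp only [not_eventually, not_lt] at hev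
  -- the test function `0` makes `a` nonnegative, hence real
  have ha0 : 0 ≤ a := by
    obtain ⟨b, hb⟩ := hev.exists
    have hmem : (0 : S →ᵇ ℝ) ∈ b • Γ₀ := ⟨0, h0, smul_zero b⟩
    refine le_trans ?_ ((le_gammaDivergence hmem μ ν).trans hb)
    simp
  have ha_top : a ≠ ⊤ := (ha.trans_le le_top).ne
  lift a to ℝ using ⟨ha_top, (EReal.bot_lt_zero.trans_le ha0).ne'⟩ with c
  have hkl := klDiv_le_of_forall_mem_span hΓ₀ μ ν (c := c) fun g hg => by
    obtain ⟨b, hb, hgb⟩ := exists_mem_smul_of_mem_span hΓ₀.convex hΓ₀.symmetric h0 hg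
    obtain ⟨d, hbd, hd⟩ := frequently_atTop.1 hev b
    exact EReal.coe_le_coe_iff.1 ((le_gammaDivergence
      (smul_set_subset_smul_set hΓ₀.convex h0 hb hbd hgb) μ ν).trans hd)
  rw [relEntropy_eq_klDiv] at ha
  have h1 : (klDiv μ ν : EReal) ≤ (ENNReal.ofReal c : EReal) :=
    EReal.coe_ennreal_le_coe_ennreal_iff.2 hkl
  rw [EReal.coe_ennreal_ofReal, max_eq_left (EReal.coe_nonneg.1 ha0)] at h1
  exact absurd ha h1.not_gt
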